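/- Let $\Lambda$ be the set of terms of the pure lambda calculus (possibly open, over a countably infinite set of variables, identified up to renaming of bound variables), and write $[N/x]B$ for capture-avoiding substitution. Define three big-step strategies call-by-name ($\mathrm{bn}$), $\mathrm{IIS}$, and head spine ($\mathrm{he}$) as partial functions $\Lambda\rightharpoonup\Lambda$ by the following rules, where $\mathrm{st}(M)=N$ holds iff it has a finite derivation, and $\mathrm{st}$ is undefined on $M$ (diverges, $\mathrm{st}(M)=\bot$) iff there is no such $N$. For each $\mathrm{st}\in\{\mathrm{bn},\mathrm{IIS},\mathrm{he}\}$: - $\mathrm{st}(x)=x$ for every variable $x$; - if $\mathrm{st}(M)=\lambda x.B$ and $\mathrm{st}([N/x]B)=B'$, then $\mathrm{st}(MN)=B'$. On abstractions, $\mathrm{bn}(\lambda x.B)=\lambda x.B$ and $\mathrm{IIS}(\lambda x.B)=\lambda x.B$, whereas $\mathrm{he}(\lambda x.B)=\lambda x.B'$ if $\mathrm{he}(B)=B'$. On applications $MN$ with $\mathrm{st}(M)=M'$ and $M'$ not an abstraction, $\mathrm{bn}(MN)=M'N$ and $\mathrm{he}(MN)=M'N$, whereas $\mathrm{IIS}(MN)=M'N'$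 if $\mathrm{IIS}(N)=N'$. A strategy $\mathrm{st}_2$ absorbs a strategy $\mathrm{st}_1$ if $\mathrm{st}_2\circ\mathrm{st}_1=\mathrm{st}_2$ as partial functions, that is, for every term $M$ either both sides are undefined at $M$, or both are defined at $M$ with the same value. **Proposition.** Both $\mathrm{IIS}$ and $\mathrm{he}$ absorb $\mathrm{bn}$: $$\mathrm{IIS}\circ\mathrm{bn}=\mathrm{IIS}\qquad\text{and}\qquad \mathrm{he}\circ\mathrm{bn}=\mathrm{he}.$$ -/

import Mathlib

namespace PureLambda

/-- Terms of the pure lambda calculus up to renaming of bound variables, in de Bruijn notation: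
a variable is bound by the abstraction found that many levels up, and it is free when there
is no such abstraction. Terms may be open, and there are countably many free variables. -/
inductive Term : Type
  | var : ℕ → Term
  | lam : Term → Term
  | app : Term → Term → Term

namespace Term

/-- Action of a renaming under one more binder. -/
def liftRen (ρ : ℕ → ℕ) : ℕ → ℕ
  | 0 => 0
  | n + 1 => ρ n + 1

/-- Renaming of the free variables. -/
def rename : (ℕ → ℕ) → Term → Term
  | ρ, var n => var (ρ n)
  | ρ, lam B => lam (rename (liftRen ρ) B)
  | ρ, app M N => app (rename ρ M) (rename ρ N)

/-- Action of a simultaneous substitution under one more binder. -/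
def liftSub (σ : ℕ → Term) : ℕ → Term
  | 0 => var 0
  | n + 1 => rename Nat.succ (σ n)

/-- Capture-avoiding simultaneous substitution of `σ n` for every free variable `n`. -/
def subst : (ℕ → Term) → Term → Term
  | σ, var n => σ n
  | σ, lam B => lam (subst (liftSub σ) B)
  | σ, app M N => app (subst σ M) (subst σ N)

/-- The substitution that maps the parameter to `N` and every other variable to itself. -/
def single (N : Term) : ℕ → Term
  | 0 => N
  | n + 1 => var n

/-- The contractum of the redex `(lam B) N`: the capture-avoiding substitution of the operand
`N` for the parameter of the abstraction in its body `B`. -/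
def contract (B N : Term) : Term := subst (single N) B

/-- Being an abstraction. -/
def IsLam (M : Term) : Prop := ∃ B, M = lam B

end Term

open Term

/-- Call-by-name in natural semantics (weak, non-strict, head): `BnEval M N` holds when there is
a finite evaluation tree for `bn(M) = N`. The rules are VAR, ABS, CON and NEU. -/
inductive BnEval : Term → Term → Prop
  | var (n : ℕ) : BnEval (var n) (var n)
  | abs (B : Term) : BnEval (lam B) (lam B)
  | con {M N B B' : Term} :
      BnEval M (lam B) → BnEval (contract B N) B' → BnEval (app M N) B'
  | neu {M N M' : Term} :
      BnEval M M' → ¬ IsLam M' → BnEval (app M N) (app M' N)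

/-- The strategy IIS in natural semantics (weak, non-strict, non-head): as call-by-name, but it
also evaluates, by itself, the operands of neutrals. -/
inductive IisEval : Term → Term → Prop
  | var (n : ℕ) : IisEval (var n) (var n)
  | abs (B : Term) : IisEval (lam B) (lam B)
  | con {M N B B' : Term} :
      IisEval M (lam B) → IisEval (contract B N) B' → IisEval (app M N) B'
  | neu {M N M' N' : Term} :
      IisEval M M' → ¬ IsLam M' → IisEval N N' → IisEval (app M N) (app M' N')

/-- Head spine in natural semantics (non-weak, non-strict, head): as call-by-name, but it also
evaluates, by itself, the bodies of abstractions. -/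
inductive HeEval : Term → Term → Prop
  | var (n : ℕ) : HeEval (var n) (var n)
  | abs {B B' : Term} : HeEval B B' → HeEval (lam B) (lam B')
  | con {M N B B' : Term} :
      HeEval M (lam B) → HeEval (contract B N) B' → HeEval (app M N) B'
  | neu {M N M' : Term} :
      HeEval M M' → ¬ IsLam M' → HeEval (app M N) (app M' N)

theorem BnEval.unique {M P Q : Term} (hP : BnEval M P) (hQ : BnEval M Q) : P = Q := by
  induction hP generalizing Q with
  | var n => cases hQ; rfl
  | abs B => cases hQ; rfl
  | con _ _ ih₁ ih₂ =>
    cases hQ with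
    | con h₁ h₂ => cases ih₁ h₁; exact ih₂ h₂
    | neu h₁ h => exact absurd ⟨_, (ih₁ h₁).symm⟩ h
  | neu _ hn ih =>
    cases hQ with
    | con h₁ _ => exact absurd ⟨_, ih h₁⟩ hn
    | neu h₁ _ => rw [ih h₁]

theorem IisEval.unique {M P Q : Term} (hP : IisEval M P) (hQ : IisEval M Q) : P = Q := by
  induction hP generalizing Q with
  | var n => cases hQ; rfl
  | abs B => cases hQ; rfl
  | con _ _ ih₁ ih₂ =>
    cases hQ with
    | con h₁ h₂ => cases ih₁ h₁; exact ih₂ h₂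
    | neu h₁ h _ => exact absurd ⟨_, (ih₁ h₁).symm⟩ h
  | neu _ hn _ ih ihN =>
    cases hQ with
    | con h₁ _ => exact absurd ⟨_, ih h₁⟩ hn
    | neu h₁ _ h₂ => rw [ih h₁, ihN h₂]

theorem HeEval.unique {M P Q : Term} (hP : HeEval M P) (hQ : HeEval M Q) : P = Q := by
  induction hP generalizing Q with
  | var n => cases hQ; rfl
  | abs _ ih => cases hQ with
    | abs h => rw [ih h]
  | con _ _ ih₁ ih₂ =>
    cases hQ with
    | con h₁ h₂ => cases ih₁ h₁; exact ih₂ h₂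
    | neu h₁ h => exact absurd ⟨_, (ih₁ h₁).symm⟩ h
  | neu _ hn ih =>
    cases hQ with
    | con h₁ _ => exact absurd ⟨_, ih h₁⟩ hn
    | neu h₁ _ => rw [ih h₁]

/-- The partial function with a given single-valued graph. -/
noncomputable def ofGraph (R : Term → Term → Prop)
    (_hR : ∀ M P Q : Term, R M P → R M Q → P = Q) : Term →. Term :=
  fun M => ⟨∃ N, R M N, fun h => h.choose⟩

theorem mem_ofGraph {R : Term → Term → Prop}
    (hR : ∀ M P Q : Term, R M P → R M Q → P = Q) {M N : Term} :
    N ∈ ofGraph R hR M ↔ R M N :=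
  ⟨fun ⟨h, e⟩ => e ▸ h.choose_spec, fun h => ⟨⟨N, h⟩, hR _ _ _ (Exists.choose_spec ⟨N, h⟩) h⟩⟩

/-- The big-step strategies, as partial functions on terms. They are undefined exactly on the
terms on which the strategy diverges: the rules are exhaustive and do not overlap, so that a term
has no finite evaluation tree if and only if its evaluation tree is infinite. -/
noncomputable def bn : Term →. Term := ofGraph BnEval fun _ _ _ => BnEval.unique

/-- See `bn`. -/
noncomputable def iis : Term →. Term := ofGraph IisEval fun _ _ _ => IisEval.unique

/-- See `bn`. -/
noncomputable def he : Term →. Term := ofGraph HeEval fun _ _ _ => HeEval.unique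

theorem mem_bn {M N : Term} : N ∈ bn M ↔ BnEval M N := mem_ofGraph _

theorem mem_iis {M N : Term} : N ∈ iis M ↔ IisEval M N := mem_ofGraph _

theorem mem_he {M N : Term} : N ∈ he M ↔ HeEval M N := mem_ofGraph _

/-- `s₂` absorbs `s₁` when `s₂ ∘ s₁ = s₂`, as an equality of partial functions: both sides are
defined on the same terms, and they deliver the same results there. -/
def Absorbs (s₂ s₁ : Term →. Term) : Prop := s₂.comp s₁ = s₂

end PureLambda

namespace PureLambda

namespace Term

/-! ### Substitution -/

/-! For IIS, induction on derivations suffices: IIS fixes abstractions, and a call-by-name result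
that is not an abstraction stays so under IIS (`BnEval.not_isLam_of_iisEval`), so both strategies
choose the same rule at every application.

For head spine this fails: the body of the operator is evaluated before contraction in `he` but not
in `bn`. Both are compared with head reduction, which is deterministic. By `heEval_iff`, `he`
computes exactly the head normal form. Call-by-name only follows head steps, and it terminates if a
head normal form exists; its result then lies on the path to that normal form. The different orders
of contraction are reconciled by closure of head reduction under substitution
(`HeadSteps.app_contract`, `HeadNormalizes.of_subst`). -/

theorem rename_congr {ρ ρ' : ℕ → ℕ} (h : ∀ n, ρ n = ρ' n) (M : Term) :
    rename ρ M = rename ρ' M := by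
  rw [funext h]

theorem subst_congr {σ σ' : ℕ → Term} (h : ∀ n, σ n = σ' n) (M : Term) :
    subst σ M = subst σ' M := by
  rw [funext h]

theorem rename_rename (ρ ρ' : ℕ → ℕ) (M : Term) :
    rename ρ' (rename ρ M) = rename (fun n => ρ' (ρ n)) M := by
  induction M generalizing ρ ρ' with
  | var n => rfl
  | lam B ih =>
    simp only [rename, ih]
    congr 1
    exact rename_congr (fun n => by cases n <;> rfl) B
  | app M N ihM ihN => simp only [rename, ihM, ihN]

theorem subst_rename (ρ : ℕ → ℕ) (σ : ℕ → Term) (M : Term) :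
    subst σ (rename ρ M) = subst (fun n => σ (ρ n)) M := by
  induction M generalizing ρ σ with
  | var n => rfl
  | lam B ih =>
    simp only [rename, subst, ih]
    congr 1
    exact subst_congr (fun n => by cases n <;> rfl) B
  | app M N ihM ihN => simp only [rename, subst, ihM, ihN]

theorem rename_subst (ρ : ℕ → ℕ) (σ : ℕ → Term) (M : Term) :
    rename ρ (subst σ M) = subst (fun n => rename ρ (σ n)) M := by
  induction M generalizing ρ σ with
  | var n => rfl
  | lam B ih =>
    simp only [rename, subst, ih]
    congr 1
    refine subst_congr (fun n => ?_) B
    cases n with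
    | zero => rfl
    | succ n =>
      simp only [liftSub, rename_rename]
      exact rename_congr (fun _ => rfl) _
  | app M N ihM ihN => simp only [rename, subst, ihM, ihN]

theorem subst_subst (σ τ : ℕ → Term) (M : Term) :
    subst τ (subst σ M) = subst (fun n => subst τ (σ n)) M := by
  induction M generalizing σ τ with
  | var n => rfl
  | lam B ih =>
    simp only [subst, ih]
    congr 1
    refine subst_congr (fun n => ?_) B
    cases n with
    | zero => rfl
    | succ n =>
      simp only [liftSub, subst_rename, rename_subst]
  | app M N ihM ihN => simp only [subst, ihM, ihN]

theorem subst_var (M : Term) : subst var M = M := by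
  induction M with
  | var n => rfl
  | lam B ih =>
    simp only [subst]
    rw [subst_congr (σ' := var) (fun n => by cases n <;> rfl) B, ih]
  | app M N ihM ihN => simp only [subst, ihM, ihN]

theorem subst_contract (σ : ℕ → Term) (B N : Term) :
    subst σ (contract B N) = contract (subst (liftSub σ) B) (subst σ N) := by
  simp only [contract, subst_subst]
  refine subst_congr (fun n => ?_) B
  cases n with
  | zero => rfl
  | succ n =>
    simp only [liftSub, subst_rename, single, subst]
    exact (subst_var _).symm

theorem not_isLam_var (n : ℕ) : ¬ IsLam (var n) := by rintro ⟨B, h⟩; cases h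

theorem not_isLam_app (M N : Term) : ¬ IsLam (app M N) := by rintro ⟨B, h⟩; cases h

end Term

open Term

/-! ### Head reduction -/

/-- One step of head reduction. -/
inductive HeadStep : Term → Term → Prop
  | beta (B N : Term) : HeadStep (app (lam B) N) (contract B N)
  | app {M M' : Term} (N : Term) : ¬ IsLam M → HeadStep M M' → HeadStep (app M N) (app M' N)
  | lam {B B' : Term} : HeadStep B B' → HeadStep (lam B) (lam B')

/-- The side condition of `HeadStep.app` forbids steps inside the operator of a redex, so the rules
do not overlap. -/
theorem HeadStep.unique {M P Q : Term} (hP : HeadStep M P) (hQ : HeadStep M Q) : P = Q := by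
  induction hP generalizing Q with
  | beta B N =>
    cases hQ with
    | beta => rfl
    | app _ h _ => exact absurd ⟨_, rfl⟩ h
  | app N hn _ ih =>
    cases hQ with
    | beta => exact absurd ⟨_, rfl⟩ hn
    | app _ _ h => rw [ih h]
  | lam _ ih => cases hQ with
    | lam h => rw [ih h]

theorem HeadStep.subst {M M' : Term} (h : HeadStep M M') (σ : ℕ → Term) :
    HeadStep (M.subst σ) (M'.subst σ) := by
  induction h generalizing σ with
  | beta B N => rw [subst_contract]; exact .beta _ _
  | @app M _ N hn h ih =>
    refine .app _ ?_ (ih σ)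
    -- A non-abstraction that takes a head step is an application, so no substitution turns it into
    -- an abstraction.
    cases h with
    | lam => exact absurd ⟨_, rfl⟩ hn
    | beta => exact not_isLam_app _ _
    | app => exact not_isLam_app _ _
  | lam _ ih => exact .lam (ih _)

/-- Head normal forms. -/
def HeadNormal (M : Term) : Prop := ∀ M', ¬ HeadStep M M'

theorem HeadNormal.var (n : ℕ) : HeadNormal (.var n) := fun _ h => nomatch h

theorem HeadNormal.lam {B : Term} (h : HeadNormal B) : HeadNormal (.lam B) := by
  rintro _ ⟨⟩
  exact h _ ‹_›

theorem HeadNormal.app {M : Term} (h : HeadNormal M) (hn : ¬ IsLam M) (N : Term) :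
    HeadNormal (.app M N) := by
  rintro _ (_ | ⟨_, _, h'⟩ | _)
  · exact hn ⟨_, rfl⟩
  · exact h _ h'

/-- Head reduction of `M` reaches the head normal form `P` after exactly `n` steps. -/
inductive HeadNormalizes : ℕ → Term → Term → Prop
  | refl {M : Term} : HeadNormal M → HeadNormalizes 0 M M
  | step {n : ℕ} {M M' P : Term} :
      HeadStep M M' → HeadNormalizes n M' P → HeadNormalizes (n + 1) M P

/-- Iterated head reduction. -/
abbrev HeadSteps : Term → Term → Prop := Relation.ReflTransGen HeadStep

theorem HeadSteps.subst {M M' : Term} (h : HeadSteps M M') (σ : ℕ → Term) :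
    HeadSteps (M.subst σ) (M'.subst σ) :=
  h.lift _ fun _ _ h => h.subst σ

theorem HeadSteps.lam {B B' : Term} (h : HeadSteps B B') : HeadSteps (.lam B) (.lam B') :=
  h.lift _ fun _ _ h => .lam h

theorem HeadSteps.of_lam {B Q : Term} (h : HeadSteps (.lam B) Q) :
    ∃ B', Q = .lam B' ∧ HeadSteps B B' := by
  induction h with
  | refl => exact ⟨B, rfl, .refl⟩
  | tail _ h ih =>
    obtain ⟨B', rfl, h'⟩ := ih
    cases h with
    | lam h => exact ⟨_, rfl, h'.tail h⟩

theorem HeadSteps.app {M M' : Term} (h : HeadSteps M M') (hn : ¬ IsLam M') (N : Term) :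
    HeadSteps (.app M N) (.app M' N) := by
  induction h using Relation.ReflTransGen.head_induction_on with
  | refl => exact .refl
  | head h₁ h₂ ih =>
    refine .head (.app _ ?_ h₁) ih
    rintro ⟨B, rfl⟩
    obtain ⟨B', rfl, -⟩ := HeadSteps.of_lam (.head h₁ h₂)
    exact hn ⟨_, rfl⟩

/-- Head reduction contracts as soon as the operator becomes an abstraction; the remaining steps of
its body are replayed in the contractum by substitutivity. That at least one step occurs is what
makes the inductions on step counts decrease. -/
theorem HeadSteps.app_contract {M B : Term} (h : HeadSteps M (.lam B)) (N : Term) :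
    Relation.TransGen HeadStep (.app M N) (contract B N) := by
  induction h using Relation.ReflTransGen.head_induction_on with
  | refl => exact .single (.beta _ _)
  | @head M _ h₁ h₂ ih =>
    by_cases hM : IsLam M
    · obtain ⟨C, rfl⟩ := hM
      obtain ⟨B', h, hC⟩ := HeadSteps.of_lam (.head h₁ h₂)
      cases h
      exact .head' (.beta _ _) (hC.subst _)
    · exact .head (.app _ hM h₁) ih

theorem HeadNormalizes.headSteps {n : ℕ} {M P : Term} (h : HeadNormalizes n M P) :
    HeadSteps M P := by
  induction h with
  | refl => exact .refl
  | step h _ ih => exact .head h ih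

theorem HeadNormalizes.headNormal {n : ℕ} {M P : Term} (h : HeadNormalizes n M P) :
    HeadNormal P := by
  induction h with
  | refl h => exact h
  | step _ _ ih => exact ih

theorem HeadNormal.exists_headNormalizes {M P : Term} (hP : HeadNormal P) (h : HeadSteps M P) :
    ∃ n, HeadNormalizes n M P := by
  induction h using Relation.ReflTransGen.head_induction_on with
  | refl => exact ⟨0, .refl hP⟩
  | head h _ ih => exact ih.imp' _ fun _ => .step h

theorem HeadNormalizes.of_headStep {n : ℕ} {M M' P : Term} (h : HeadNormalizes n M P)
    (hs : HeadStep M M') : ∃ k, n = k + 1 ∧ HeadNormalizes k M' P := by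
  cases h with
  | refl h => exact absurd hs (h _)
  | step h₁ h₂ => exact ⟨_, rfl, h₁.unique hs ▸ h₂⟩

theorem HeadNormalizes.of_headSteps {n : ℕ} {M M' P : Term} (h : HeadNormalizes n M P)
    (hs : HeadSteps M M') : ∃ k ≤ n, HeadNormalizes k M' P := by
  induction hs with
  | refl => exact ⟨n, le_rfl, h⟩
  | tail _ h' ih =>
    obtain ⟨k, hk, hP⟩ := ih
    obtain ⟨m, rfl, hm⟩ := hP.of_headStep h'
    exact ⟨m, by omega, hm⟩

theorem HeadNormalizes.of_transGen {n : ℕ} {M M' P : Term} (h : HeadNormalizes n M P)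
    (hs : Relation.TransGen HeadStep M M') : ∃ k < n, HeadNormalizes k M' P := by
  obtain ⟨_, h₁, h₂⟩ := Relation.TransGen.head'_iff.1 hs
  obtain ⟨m, rfl, hm⟩ := h.of_headStep h₁
  obtain ⟨k, hk, hP⟩ := hm.of_headSteps h₂
  exact ⟨k, by omega, hP⟩

/-- If an instance of `C` has a head normal form, then so does `C`, in no more steps. -/
theorem HeadNormalizes.of_subst {n : ℕ} {C P : Term} {σ : ℕ → Term}
    (h : HeadNormalizes n (C.subst σ) P) : ∃ k ≤ n, ∃ C', HeadNormalizes k C C' := by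
  induction n generalizing C with
  | zero =>
    refine ⟨0, le_rfl, C, .refl fun C' hC => ?_⟩
    obtain ⟨k, hk, -⟩ := h.of_headStep (hC.subst σ)
    omega
  | succ n ih =>
    by_cases hC : HeadNormal C
    · exact ⟨0, by omega, C, .refl hC⟩
    · simp only [HeadNormal, not_forall, not_not] at hC
      obtain ⟨C₁, hC⟩ := hC
      obtain ⟨m, hm, h'⟩ := h.of_headStep (hC.subst σ)
      cases hm
      obtain ⟨k, hk, C', hC'⟩ := ih h'
      exact ⟨k + 1, by omega, C', .step hC hC'⟩

theorem HeadNormalizes.lam {n : ℕ} {B B' : Term} (h : HeadNormalizes n B B') :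
    HeadNormalizes n (.lam B) (.lam B') := by
  induction h with
  | refl h => exact .refl h.lam
  | step h _ ih => exact .step (.lam h) ih

theorem HeadNormalizes.of_lam {n : ℕ} {B P : Term} (h : HeadNormalizes n (.lam B) P) :
    ∃ B', P = .lam B' ∧ HeadNormalizes n B B' := by
  induction n generalizing B with
  | zero =>
    cases h with
    | refl h => exact ⟨B, rfl, .refl fun _ hB => h _ (.lam hB)⟩
  | succ n ih =>
    obtain _ | ⟨⟨⟩, h⟩ := h
    obtain ⟨B', rfl, hB⟩ := ih h
    exact ⟨B', rfl, .step ‹_› hB⟩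

/-- If an application has a head normal form, then so does its operator, in no more steps. -/
theorem HeadNormalizes.of_app {n : ℕ} {M N P : Term} (h : HeadNormalizes n (.app M N) P) :
    ∃ k ≤ n, ∃ M', HeadNormalizes k M M' := by
  induction n generalizing M with
  | zero =>
    by_cases hM : IsLam M
    · obtain ⟨C, rfl⟩ := hM
      obtain ⟨k, hk, -⟩ := h.of_headStep (.beta _ _)
      omega
    · refine ⟨0, le_rfl, M, .refl fun M' hM' => ?_⟩
      obtain ⟨k, hk, -⟩ := h.of_headStep (.app _ hM hM')
      omega
  | succ n ih =>
    by_cases hM : IsLam M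
    · obtain ⟨C, rfl⟩ := hM
      obtain ⟨m, hm, h'⟩ := h.of_headStep (.beta _ _)
      -- The contractum is a substitution instance of the body `C`.
      obtain ⟨k, hk, C', hC'⟩ := h'.of_subst
      exact ⟨k, by omega, _, hC'.lam⟩
    · by_cases hM₀ : HeadNormal M
      · exact ⟨0, by omega, M, .refl hM₀⟩
      · simp only [HeadNormal, not_forall, not_not] at hM₀
        obtain ⟨M₁, hM₁⟩ := hM₀
        obtain ⟨m, hm, h'⟩ := h.of_headStep (.app _ hM hM₁)
        cases hm
        obtain ⟨k, hk, M', hM'⟩ := ih h'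
        exact ⟨k + 1, by omega, M', .step hM₁ hM'⟩

theorem HeadNormalizes.eq_of_headSteps {n : ℕ} {M P Q : Term} (h : HeadNormalizes n M P)
    (hs : HeadSteps M Q) (hQ : HeadNormal Q) : P = Q := by
  obtain ⟨k, -, hk⟩ := h.of_headSteps hs
  cases hk with
  | refl => rfl
  | step h _ => exact absurd h (hQ _)

/-! ### Head spine computes head normal forms -/

theorem HeEval.headSteps {M P : Term} (h : HeEval M P) : HeadSteps M P ∧ HeadNormal P := by
  induction h with
  | var n => exact ⟨.refl, .var n⟩
  | abs _ ih => exact ⟨ih.1.lam, ih.2.lam⟩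
  | con _ _ ih₁ ih₂ => exact ⟨(ih₁.1.app_contract _).to_reflTransGen.trans ih₂.1, ih₂.2⟩
  | neu _ hn ih => exact ⟨ih.1.app hn _, ih.2.app hn _⟩

theorem HeadNormalizes.heEval {n : ℕ} {M P : Term} (h : HeadNormalizes n M P) : HeEval M P := by
  induction n using Nat.strong_induction_on generalizing M P with
  | _ n ihn =>
  -- Lexicographic induction on the number of steps, then on the term: the operator is a smaller
  -- term needing no more steps, and the contractum needs strictly fewer.
  suffices H : ∀ k ≤ n, ∀ P, HeadNormalizes k M P → HeEval M P from H n le_rfl P h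
  clear h P
  induction M with
  | var i =>
    rintro k - P (_ | ⟨⟨⟩, _⟩)
    exact .var i
  | lam B ih =>
    intro k hk P h
    obtain ⟨B', rfl, hB⟩ := h.of_lam
    exact .abs (ih k hk B' hB)
  | app M N ih _ =>
    intro k hk P h
    obtain ⟨m, hm, M', hM⟩ := h.of_app
    have hM' := ih m (hm.trans hk) M' hM
    by_cases hl : IsLam M'
    · obtain ⟨B, rfl⟩ := hl
      obtain ⟨j, hj, hP⟩ := h.of_transGen (hM.headSteps.app_contract N)
      exact .con hM' (ihn j (by omega) hP)
    · rw [h.eq_of_headSteps (hM.headSteps.app hl N) (hM.headNormal.app hl N)]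
      exact .neu hM' hl

theorem heEval_iff {M P : Term} : HeEval M P ↔ HeadSteps M P ∧ HeadNormal P :=
  ⟨HeEval.headSteps, fun ⟨h, hP⟩ => (hP.exists_headNormalizes h).elim fun _ => (·.heEval)⟩

/-! ### Call-by-name and head reduction -/

theorem BnEval.headSteps {M Q : Term} (h : BnEval M Q) : HeadSteps M Q := by
  induction h with
  | var n => exact .refl
  | abs B => exact .refl
  | con _ _ ih₁ ih₂ => exact (ih₁.app_contract _).to_reflTransGen.trans ih₂
  | neu _ hn ih => exact ih.app hn _

theorem HeadNormalizes.exists_bnEval {n : ℕ} {M P : Term} (h : HeadNormalizes n M P) :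
    ∃ Q, BnEval M Q := by
  induction n using Nat.strong_induction_on generalizing M P with
  | _ n ihn =>
  -- The same lexicographic induction as in `HeadNormalizes.heEval`.
  suffices H : ∀ k ≤ n, ∀ P, HeadNormalizes k M P → ∃ Q, BnEval M Q from H n le_rfl P h
  clear h P
  induction M with
  | var i => exact fun _ _ _ _ => ⟨_, .var i⟩
  | lam B _ => exact fun _ _ _ _ => ⟨_, .abs B⟩
  | app M N ih _ =>
    intro k hk P h
    obtain ⟨m, hm, M', hM⟩ := h.of_app
    obtain ⟨Q, hQ⟩ := ih m (hm.trans hk) M' hM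
    by_cases hl : IsLam Q
    · obtain ⟨B, rfl⟩ := hl
      obtain ⟨j, hj, hP⟩ := h.of_transGen (hQ.headSteps.app_contract N)
      exact (ihn j (by omega) hP).imp fun _ => .con hQ
    · exact ⟨_, .neu hQ hl⟩

theorem heEval_iff_exists_bnEval {M P : Term} :
    HeEval M P ↔ ∃ Q, BnEval M Q ∧ HeEval Q P := by
  constructor
  · intro h
    obtain ⟨hs, hP⟩ := heEval_iff.1 h
    obtain ⟨n, hn⟩ := hP.exists_headNormalizes hs
    obtain ⟨Q, hQ⟩ := hn.exists_bnEval
    -- By determinism, `Q` lies on the head reduction path from `M` to `P`.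
    obtain ⟨k, -, hk⟩ := hn.of_headSteps hQ.headSteps
    exact ⟨Q, hQ, hk.heEval⟩
  · rintro ⟨Q, hQ, h⟩
    obtain ⟨hs, hP⟩ := heEval_iff.1 h
    exact heEval_iff.2 ⟨hQ.headSteps.trans hs, hP⟩

/-! ### Call-by-name and IIS -/

/-- The strategy IIS takes a result of call-by-name that is not an abstraction to a term that is
not an abstraction. -/
theorem BnEval.not_isLam_of_iisEval {M Q P : Term} (h : BnEval M Q) (hQ : ¬ IsLam Q)
    (hP : IisEval Q P) : ¬ IsLam P := by
  induction h generalizing P with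
  | var n => cases hP; exact not_isLam_var n
  | abs B => exact absurd ⟨_, rfl⟩ hQ
  | con _ _ _ ih => exact ih hQ hP
  | neu _ hn ih =>
    cases hP with
    | con h _ => exact absurd ⟨_, rfl⟩ (ih hn h)
    | neu => exact not_isLam_app _ _

theorem IisEval.exists_bnEval {M P : Term} (h : IisEval M P) :
    ∃ Q, BnEval M Q ∧ IisEval Q P := by
  induction h with
  | var n => exact ⟨_, .var n, .var n⟩
  | abs B => exact ⟨_, .abs B, .abs B⟩
  | con _ _ ih₁ ih₂ =>
    obtain ⟨Q, hQ, h⟩ := ih₁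
    obtain ⟨R, hR, h'⟩ := ih₂
    by_cases hl : IsLam Q
    · obtain ⟨C, rfl⟩ := hl
      -- IIS fixes abstractions, so `C` is the very body that IIS contracts.
      cases h
      exact ⟨R, .con hQ hR, h'⟩
    · exact absurd ⟨_, rfl⟩ (hQ.not_isLam_of_iisEval hl h)
  | neu _ hn hN ih _ =>
    obtain ⟨Q, hQ, h⟩ := ih
    refine ⟨_, .neu hQ ?_, .neu h hn hN⟩
    rintro ⟨C, rfl⟩
    cases h
    exact hn ⟨_, rfl⟩

theorem BnEval.iisEval {M Q P : Term} (h : BnEval M Q) (hP : IisEval Q P) : IisEval M P := by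
  induction h generalizing P with
  | var n => exact hP
  | abs B => exact hP
  | con _ _ ih₁ ih₂ => exact .con (ih₁ (.abs _)) (ih₂ hP)
  | neu h hn ih =>
    cases hP with
    | con h' _ => exact absurd ⟨_, rfl⟩ (h.not_isLam_of_iisEval hn h')
    | neu h' hn' hN => exact .neu (ih h') hn' hN

theorem iisEval_iff_exists_bnEval {M P : Term} :
    IisEval M P ↔ ∃ Q, BnEval M Q ∧ IisEval Q P :=
  ⟨IisEval.exists_bnEval, fun ⟨_, hQ, h⟩ => hQ.iisEval h⟩

theorem absorbs_iff {s₂ s₁ : Term →. Term} :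
    Absorbs s₂ s₁ ↔ ∀ M P, P ∈ s₂ M ↔ ∃ Q, Q ∈ s₁ M ∧ P ∈ s₂ Q := by
  simp only [Absorbs, PFun.ext_iff, PFun.comp_apply]
  exact forall₂_congr fun _ _ => (iff_congr Part.mem_bind_iff Iff.rfl).trans iff_comm

end PureLambda

theorem proposition7p7 :
    PureLambda.Absorbs PureLambda.iis PureLambda.bn ∧
      PureLambda.Absorbs PureLambda.he PureLambda.bn := by
  simp only [PureLambda.absorbs_iff, PureLambda.mem_iis, PureLambda.mem_bn, PureLambda.mem_he]
  exact ⟨fun _ _ => PureLambda.iisEval_iff_exists_bnEval,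
    fun _ _ => PureLambda.heEval_iff_exists_bnEval⟩
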